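/- Let $\Omega=\{x\in\mathbb{R}^2:|x|<1\}$ be the unit disk. For a point $x^*$ with $|x^*|=1$ and $0<\varepsilon<\pi$, let $\partial\Omega_a\subset\partial\Omega$ be the open arc with centre $x^*$ and length $2\varepsilon$, and let $\partial\Omega_r=\partial\Omega\setminus\overline{\partial\Omega_a}$. Let $u_\varepsilon$ be the solution of $$\Delta u_\varepsilon=-1\ \text{ in }\Omega,\qquad u_\varepsilon=0\ \text{ on }\partial\Omega_a,\qquad \frac{\partial u_\varepsilon}{\partial\nu}=0\ \text{ on }\partial\Omega_r,$$ that is, the unique function in $C^2(\Omega)\cap C^0(\overline\Omega)$ that satisfies these three conditions pointwise, where $\nu$ is the outward unit normal and the normal derivative is the one-sided derivative from inside $\Omega$; such a function exists and is unique for all $x^*$ and $\varepsilon$ as above. Then, as $\varepsilon\to0$, $$u_\varepsilon(x)=\ln\frac{2}{\varepsilon}+\frac14\bigl(1-|x|^2\bigr)+\ln|x-x^*|+O(\varepsilon),$$ where for every fixed $c>0$ the remainder is uniform in $x\in\Omega$ with $\operatorname{dist}(x,\partial\Omega_a)\ge c$. That is, for every $c>0$ there are constants $C$ and $\varepsilon_0>0$,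 depending only on $c$, such that for all $x^*\in\partial\Omega$, all $0<\varepsilon<\varepsilon_0$ and all $x\in\Omega$ with $\operatorname{dist}(x,\partial\Omega_a)\ge c$ the remainder is at most $C\varepsilon$ in absolute value. -/

import Mathlib

namespace NarrowEscape

/-- The open arc of the unit circle with centre `p` (a point with `‖p‖ = 1`) and half-length `ε`.
The plane is identified with `ℂ`; as the circle has radius one, `t ↦ p * exp (i t)` is the
arclength parametrization, so for `0 < ε < π` the arc has length `2 * ε`. -/
def absorbingArc (p : ℂ) (ε : ℝ) : Set ℂ :=
  (fun t : ℝ => p * Complex.exp (t * Complex.I)) '' Set.Ioo (-ε) ε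

/-- The complementary open arc of the unit circle (the circle without the closed absorbing arc). -/
def reflectingArc (p : ℂ) (ε : ℝ) : Set ℂ :=
  (fun t : ℝ => p * Complex.exp (t * Complex.I)) '' Set.Ioo ε (2 * Real.pi - ε)

/-- `u` has outward normal derivative `d` at the point `z` of the unit circle: the one-sided
derivative, from inside the disk, in the direction of the outward unit normal `ν = z`. -/
def HasNormalDeriv (u : ℂ → ℝ) (d : ℝ) (z : ℂ) : Prop :=
  HasDerivWithinAt (fun r : ℝ => u (r • z)) d (Set.Iic 1) 1

/-- `u` is a (classical) solution of the mixed boundary value problem in the unit disk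
`Δ u = -1` in the disk, `u = 0` on the absorbing arc, `∂u/∂ν = 0` on the reflecting arc.
It is twice continuously differentiable in the open disk and continuous up to the boundary;
nothing more is asked at the two endpoints of the arcs. Only the values of `u` on the
closed disk matter. -/
structure IsSolution (p : ℂ) (ε : ℝ) (u : ℂ → ℝ) : Prop where
  contDiffOn : ContDiffOn ℝ 2 u (Metric.ball 0 1)
  continuousOn : ContinuousOn u (Metric.closedBall 0 1)
  laplacian_eq : ∀ x ∈ Metric.ball (0 : ℂ) 1, Laplacian.laplacian u x = (-1 : ℝ)
  dirichlet : ∀ z ∈ absorbingArc p ε, u z = 0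
  neumann : ∀ z ∈ reflectingArc p ε, HasNormalDeriv u 0 z

end NarrowEscape

namespace NarrowEscape

open Complex Metric Set Filter Topology InnerProductSpace ComplexConjugate

/-! The solution is explicit. Rotate the centre of the arc to `1` by `z = conj p * x`, put `ω = exp
(ε * I)`, `S = √((1 - z ω)(1 - z conj ω))` and `F = 1 - z + S`. On the absorbing arc `1 - z` and `S`
are orthogonal, so `|F|` is constant (`sq_norm_arcFactor`); on the reflecting arc `log |F|` has
normal derivative `1/2` (`re_logDeriv_arcFactor`), which cancels that of `(1 - |x|²)/4`. Hence
`escapeTime` solves the problem.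

Uniqueness (`IsSolution.le`) is a maximum principle: a Hopf lemma, derived from Harnack, excludes a
positive maximum on the reflecting arc. Away from the arc `S = 1 - z + O(ε)`, so `F ≈ 2(1 - z)`, and
the expansion follows (`norm_arcRoot_sub_le`). -/

/-! ### Maximum principle and uniqueness -/

/-- **Harnack's inequality** on the unit disk, in the form of an upper bound for a harmonic
function that is bounded above. -/
lemma harnack_upper_bound {v : ℂ → ℝ} (hv : HarmonicOnNhd v (ball 0 1)) {M : ℝ}
    (hM : ∀ x ∈ ball (0 : ℂ) 1, v x ≤ M) {x : ℂ} (hx : x ∈ ball (0 : ℂ) 1) :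
    (M - v 0) * (1 - ‖x‖) ≤ (M - v x) * (1 + ‖x‖) := by
  obtain ⟨f, hf, hfv⟩ := hv.exists_analyticOnNhd_ball_re_eq
  have h0 : (0 : ℂ) ∈ ball (0 : ℂ) 1 := by simp
  have hx1 : ‖x‖ < 1 := by simpa using hx
  rcases (hM 0 h0).eq_or_lt with h | h
  · rw [h, sub_self, zero_mul]
    exact mul_nonneg (sub_nonneg.2 (hM x hx)) (by positivity)
  have hfv' : ∀ y ∈ ball (0 : ℂ) 1, (f y).re = v y := hfv
  set A : ℝ := M - v 0 with hA
  have hA0 : 0 < A := sub_pos.2 h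
  have hre : ∀ y ∈ ball (0 : ℂ) 1, (f y - f 0).re ≤ A := fun y hy => by
    rw [sub_re, hfv' y hy, hfv' 0 h0]
    linarith [hM y hy]
  have hne : ∀ y ∈ ball (0 : ℂ) 1, 2 * (A : ℂ) - (f y - f 0) ≠ 0 := fun y hy h => by
    have h1 := congrArg re h
    have h2 := hre y hy
    simp only [sub_re, mul_re, ofReal_re, ofReal_im, re_ofNat, im_ofNat, zero_re] at h1 h2
    linarith
  have hd : DifferentiableOn ℂ (fun y => f y - f 0) (ball 0 1) :=
    hf.differentiableOn.sub_const _
  have hle : ∀ y ∈ ball (0 : ℂ) 1, ‖f y - f 0‖ ≤ ‖2 * (A : ℂ) - (f y - f 0)‖ := fun y hy => by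
    have h2 := hre y hy
    rw [← sq_le_sq₀ (norm_nonneg _) (norm_nonneg _), Complex.sq_norm, Complex.sq_norm,
      normSq_apply, normSq_apply]
    simp only [sub_re, sub_im, mul_re, mul_im, ofReal_re, ofReal_im, re_ofNat, im_ofNat] at h2 ⊢
    nlinarith
  -- Schwarz lemma: `w ↦ w / (2A - w)` maps the half-plane `re w ≤ A` into the closed unit disk and
  -- fixes `0`.
  have hs := norm_le_norm_of_mapsTo_ball (R := 1)
    (f := fun y => (f y - f 0) / (2 * (A : ℂ) - (f y - f 0)))
    (hd.div (hd.const_sub _) hne)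
    (fun y hy => by
      rw [mem_closedBall_zero_iff, norm_div]
      exact div_le_one_of_le₀ (hle y hy) (norm_nonneg _)) (by simp) hx1
  rw [norm_div, div_le_iff₀ (norm_pos_iff.2 (hne x hx)),
    ← sq_le_sq₀ (norm_nonneg _) (by positivity), mul_pow, Complex.sq_norm (f x - f 0),
    Complex.sq_norm (2 * (A : ℂ) - _), normSq_apply, normSq_apply] at hs
  have h2 := hre x hx
  have hvx : M - v x = A - (f x - f 0).re := by
    rw [sub_re, hfv' x hx, hfv' 0 h0]; ring
  rw [hvx]
  simp only [sub_re (2 * (A : ℂ)), sub_im (2 * (A : ℂ)), mul_re, mul_im, ofReal_re, ofReal_im,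
    re_ofNat, im_ofNat] at hs
  set a := (f x - f 0).re
  set b := (f x - f 0).im
  set ρ := ‖x‖
  have hρ : 0 ≤ ρ := norm_nonneg x
  have hs2 : a ^ 2 ≤ (ρ * (2 * A - a)) ^ 2 := by
    nlinarith [mul_nonneg (mul_self_nonneg b) (by nlinarith : 0 ≤ 1 - ρ ^ 2)]
  have hs3 : a ≤ ρ * (2 * A - a) :=
    (le_abs_self a).trans (abs_le_of_sq_le_sq hs2 (mul_nonneg hρ (by linarith)))
  nlinarith

/-- A harmonic function on the disk that attains its maximum at the centre is constant. -/
lemma eq_of_forall_le_center {v : ℂ → ℝ} (hv : HarmonicOnNhd v (ball 0 1))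
    (hM : ∀ x ∈ ball (0 : ℂ) 1, v x ≤ v 0) {x : ℂ} (hx : x ∈ ball (0 : ℂ) 1) : v x = v 0 := by
  obtain ⟨f, hf, hfv⟩ := hv.exists_analyticOnNhd_ball_re_eq
  have hfv' : ∀ y ∈ ball (0 : ℂ) 1, (f y).re = v y := hfv
  have h0 : (0 : ℂ) ∈ ball (0 : ℂ) 1 := by simp
  have := norm_eqOn_of_isPreconnected_of_isMaxOn (f := fun y => exp (f y))
    (convex_ball (0 : ℂ) 1).isPreconnected isOpen_ball hf.differentiableOn.cexp h0
    (fun y hy => by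
      simpa [norm_exp, hfv' y hy, hfv' 0 h0] using hM y hy) hx
  simpa [norm_exp, hfv' x hx, hfv' 0 h0] using this

/-- Hopf's lemma: by Harnack the radial difference quotients at `z` are at least `(v z - v 0) / 2 >
0`. -/
lemma not_hasNormalDeriv_zero_of_lt {v : ℂ → ℝ} (hv : HarmonicOnNhd v (ball 0 1)) {z : ℂ}
    (hz : ‖z‖ = 1) (hM : ∀ x ∈ ball (0 : ℂ) 1, v x ≤ v z) (h0 : v 0 < v z) :
    ¬ HasNormalDeriv v 0 z := by
  intro h
  have hc : Tendsto (fun r : ℝ => slope (fun r : ℝ => v (r • z)) 1 r) (𝓝[Iio 1] 1) (𝓝 0) := by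
    have := hasDerivWithinAt_iff_tendsto_slope.1 h
    simpa using this
  have hev : ∀ᶠ r : ℝ in 𝓝[Iio 1] 1,
      (v z - v 0) / 2 ≤ slope (fun r : ℝ => v (r • z)) 1 r := by
    have hr0 : ∀ᶠ r : ℝ in 𝓝[Iio 1] 1, 0 < r :=
      nhdsWithin_le_nhds (lt_mem_nhds one_pos)
    filter_upwards [hr0, self_mem_nhdsWithin] with r hr0 hr1
    have hr1 : r < 1 := hr1
    have hnorm : ‖r • z‖ = r := by rw [norm_smul, hz, mul_one, Real.norm_of_nonneg hr0.le]
    have hmem : r • z ∈ ball (0 : ℂ) 1 := by rwa [mem_ball_zero_iff, hnorm]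
    have := harnack_upper_bound hv hM hmem
    rw [hnorm] at this
    have hvz := hM _ hmem
    rw [slope_def_field, one_smul, ← neg_sub (v z), ← neg_sub 1 r, neg_div_neg_eq,
      le_div_iff₀ (by linarith)]
    nlinarith
  have := ge_of_tendsto hc hev
  linarith

lemma norm_absorbingArc {p z : ℂ} {ε : ℝ} (hp : ‖p‖ = 1) (hz : z ∈ absorbingArc p ε) :
    ‖z‖ = 1 := by
  obtain ⟨t, -, rfl⟩ := hz
  simp [hp, norm_exp_ofReal_mul_I]

lemma mem_closure_absorbingArc_or_mem_reflectingArc {p z : ℂ} {ε : ℝ} (hp : ‖p‖ = 1)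
    (hε : 0 < ε) (hε' : ε < Real.pi) (hz : ‖z‖ = 1) :
    z ∈ closure (absorbingArc p ε) ∨ z ∈ reflectingArc p ε := by
  have hp0 : p ≠ 0 := by rintro rfl; simp at hp
  set θ := arg (z / p)
  have hzθ : z = p * exp (θ * I) := by
    have := norm_mul_exp_arg_mul_I (z / p)
    rw [norm_div, hz, hp, div_one, ofReal_one, one_mul] at this
    rw [this]; field_simp
  have hθ1 : -Real.pi < θ := neg_pi_lt_arg _
  have hθ2 : θ ≤ Real.pi := arg_le_pi _
  by_cases h : θ ∈ Icc (-ε) ε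
  · left
    have hcont : Continuous fun t : ℝ => p * exp (t * I) := by fun_prop
    have := image_closure_subset_closure_image hcont (s := Ioo (-ε) ε)
    rw [closure_Ioo (by linarith)] at this
    exact this ⟨θ, h, hzθ.symm⟩
  · right
    rw [mem_Icc, not_and_or, not_le, not_le] at h
    rcases h with h | h
    · refine ⟨θ + 2 * Real.pi, ⟨by linarith, by linarith⟩, ?_⟩
      rw [hzθ]
      simp only [ofReal_add, ofReal_mul, ofReal_ofNat, add_mul, exp_add, exp_two_pi_mul_I, mul_one]
    · exact ⟨θ, ⟨h, by linarith⟩, hzθ.symm⟩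

/-- The difference is harmonic. A positive maximum cannot lie inside the disk (Harnack), on the
closed absorbing arc (value zero, at the endpoints by continuity) or on the reflecting arc (Hopf).
-/
lemma IsSolution.le {p : ℂ} {ε : ℝ} (hp : ‖p‖ = 1) (hε : 0 < ε) (hε' : ε < Real.pi)
    {u v : ℂ → ℝ} (hu : IsSolution p ε u) (hv : IsSolution p ε v) {x : ℂ}
    (hx : x ∈ closedBall (0 : ℂ) 1) : v x ≤ u x := by
  have hw : HarmonicOnNhd (v - u) (ball 0 1) := fun y hy => by
    have key : ∀ y ∈ ball (0 : ℂ) 1, Laplacian.laplacian (v - u) y = 0 := fun y hy => by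
      have hn := isOpen_ball.mem_nhds hy
      rw [(hv.contDiffOn.contDiffAt hn).laplacian_sub (hu.contDiffOn.contDiffAt hn),
        hv.laplacian_eq y hy, hu.laplacian_eq y hy, sub_self]
    have hn := isOpen_ball.mem_nhds hy
    refine ⟨(hv.contDiffOn.contDiffAt hn).sub (hu.contDiffOn.contDiffAt hn), ?_⟩
    filter_upwards [hn] with y hy using key y hy
  have hwc : ContinuousOn (v - u) (closedBall 0 1) := hv.continuousOn.sub hu.continuousOn
  have hsub := ball_subset_closedBall (x := (0 : ℂ)) (ε := 1)
  have harc : absorbingArc p ε ⊆ closedBall 0 1 := fun z hz => by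
    simp [norm_absorbingArc hp hz]
  have hzero : ∀ z ∈ closure (absorbingArc p ε), (v - u) z = 0 := fun z hz => by
    have hcl : closure (absorbingArc p ε) ⊆ closedBall 0 1 :=
      closure_minimal harc isClosed_closedBall
    have : EqOn (v - u) (fun _ => 0) (closure (absorbingArc p ε)) :=
      EqOn.of_subset_closure (fun z hz => by simp [hv.dirichlet z hz, hu.dirichlet z hz])
        (hwc.mono hcl) continuousOn_const subset_closure Subset.rfl
    exact this hz
  obtain ⟨z, hz, hmax⟩ := (isCompact_closedBall (0 : ℂ) 1).exists_isMaxOn ⟨0, by simp⟩ hwc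
  have hmax' : ∀ y ∈ closedBall (0 : ℂ) 1, (v - u) y ≤ (v - u) z := fun y hy => hmax hy
  suffices h : (v - u) z ≤ 0 by
    have := hmax' x hx
    simp only [Pi.sub_apply] at this h
    linarith
  by_contra! hpos
  have h0 : (v - u) 0 < (v - u) z := by
    refine (hmax' 0 (by simp)).lt_of_ne fun h => ?_
    have hconst : EqOn (v - u) (fun _ => (v - u) 0) (closedBall 0 1) := by
      refine EqOn.of_subset_closure (s := ball 0 1)
        (fun y hy => eq_of_forall_le_center hw (fun y hy => h ▸ hmax' y (hsub hy)) hy)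
        hwc continuousOn_const hsub ?_
      rw [closure_ball _ one_ne_zero]
    have hpa : p ∈ absorbingArc p ε := ⟨0, ⟨by linarith, hε⟩, by simp⟩
    have h1 := hconst (harc hpa)
    rw [hzero p (subset_closure hpa)] at h1
    rw [← h] at hpos
    exact hpos.ne h1
  have hz1 : ‖z‖ = 1 := by
    refine (mem_closedBall_zero_iff.1 hz).eq_of_not_lt fun hlt => ?_
    have := harnack_upper_bound hw (fun y hy => hmax' y (hsub hy)) (mem_ball_zero_iff.2 hlt)
    rw [sub_self, zero_mul] at this
    exact this.not_gt (mul_pos (sub_pos.2 h0) (sub_pos.2 hlt))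
  rcases mem_closure_absorbingArc_or_mem_reflectingArc hp hε hε' hz1 with hza | hzr
  · exact hpos.ne' (hzero z hza)
  · refine not_hasNormalDeriv_zero_of_lt hw hz1 (fun y hy => hmax' y (hsub hy)) h0 ?_
    have := HasDerivWithinAt.sub (hv.neumann z hzr) (hu.neumann z hzr)
    rw [sub_self] at this
    exact this

/-! ### Square roots and the branch `arcRoot` -/

lemma sq_sqrt (w : ℂ) : Complex.sqrt w ^ 2 = w := cpow_nat_inv_pow w two_ne_zero

lemma re_sqrt (w : ℂ) : (Complex.sqrt w).re = √((‖w‖ + w.re) / 2) := cpow_inv_two_re w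

lemma norm_sq_sqrt (w : ℂ) : ‖Complex.sqrt w‖ ^ 2 = ‖w‖ := by rw [← norm_pow, sq_sqrt]

/-- The case `w = 0` is included, which gives continuity of `arcRoot` at the endpoints of the arcs.
-/
lemma continuousAt_sqrt {w : ℂ} (hw : 0 ≤ w.re) : ContinuousAt Complex.sqrt w :=
  continuousAt_cpow_const_of_re_pos (Or.inl hw) (by norm_num)

lemma analyticAt_sqrt {w : ℂ} (hw : 0 < w.re) : AnalyticAt ℂ Complex.sqrt w :=
  analyticAt_id.cpow analyticAt_const (Or.inl hw)

/-- The branch of the square root of `1 - 2 * ω.re * z + z ^ 2` with value `1` at the origin, for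
`ω` on the unit circle and `z` in the closed unit disk. -/
noncomputable def arcRoot (ω z : ℂ) : ℂ := Complex.sqrt (1 - z * ω) * Complex.sqrt (1 - z * conj ω)

lemma sq_arcRoot {ω : ℂ} (hω : ‖ω‖ = 1) (z : ℂ) :
    arcRoot ω z ^ 2 = 1 - 2 * ω.re * z + z ^ 2 := by
  have h1 : ω * conj ω = 1 := by rw [mul_conj, normSq_eq_norm_sq, hω]; simp
  have h2 : ω + conj ω = 2 * ω.re := by rw [add_conj, ofReal_mul, ofReal_ofNat]
  rw [arcRoot, mul_pow, sq_sqrt, sq_sqrt]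
  linear_combination z ^ 2 * h1 - z * h2

lemma re_one_sub_nonneg {w : ℂ} (hw : ‖w‖ ≤ 1) : 0 ≤ (1 - w).re := by
  have := re_le_norm w
  rw [sub_re, one_re]; linarith

lemma re_one_sub_pos {w : ℂ} (hw : ‖w‖ ≤ 1) (h : w ≠ 1) : 0 < (1 - w).re := by
  refine (re_one_sub_nonneg hw).lt_of_ne fun h0 => h ?_
  rw [sub_re, one_re] at h0
  have h1 := normSq_apply w
  rw [normSq_eq_norm_sq] at h1
  have h2 : w.im = 0 := by nlinarith [norm_nonneg w]
  apply Complex.ext <;> simp <;> linarith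

lemma norm_mul_unit {ω : ℂ} (hω : ‖ω‖ = 1) (z : ℂ) : ‖z * ω‖ = ‖z‖ ∧ ‖z * conj ω‖ = ‖z‖ := by
  simp [hω]

lemma continuousAt_arcRoot {ω z : ℂ} (hω : ‖ω‖ = 1) (hz : ‖z‖ ≤ 1) :
    ContinuousAt (arcRoot ω) z := by
  obtain ⟨h1, h2⟩ := norm_mul_unit hω z
  refine ContinuousAt.mul ?_ ?_
  · exact ContinuousAt.comp' (continuousAt_sqrt (re_one_sub_nonneg (h1.trans_le hz))) (by fun_prop)
  · exact ContinuousAt.comp' (continuousAt_sqrt (re_one_sub_nonneg (h2.trans_le hz))) (by fun_prop)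

lemma analyticAt_arcRoot {ω z : ℂ} (hω : ‖ω‖ = 1) (hz : ‖z‖ ≤ 1) (h : z * ω ≠ 1)
    (h' : z * conj ω ≠ 1) : AnalyticAt ℂ (arcRoot ω) z := by
  obtain ⟨h1, h2⟩ := norm_mul_unit hω z
  refine AnalyticAt.mul ?_ ?_
  · exact AnalyticAt.fun_comp (analyticAt_sqrt (re_one_sub_pos (h1.trans_le hz) h)) (by fun_prop)
  · exact AnalyticAt.fun_comp (analyticAt_sqrt (re_one_sub_pos (h2.trans_le hz) h')) (by fun_prop)

/-- The derivative of `arcRoot`, obtained by differentiating its square. -/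
lemma hasDerivAt_arcRoot {ω z : ℂ} (hω : ‖ω‖ = 1) (hz : ‖z‖ ≤ 1) (h : z * ω ≠ 1)
    (h' : z * conj ω ≠ 1) (hS : arcRoot ω z ≠ 0) :
    HasDerivAt (arcRoot ω) ((z - ω.re) / arcRoot ω z) z := by
  have hd := (analyticAt_arcRoot hω hz h h').differentiableAt.hasDerivAt
  have h1 := hd.pow 2
  have h2 : HasDerivAt (fun z : ℂ => 1 - 2 * ω.re * z + z ^ 2) (- (2 * ω.re) + 2 * z) z := by
    have := ((hasDerivAt_id z).const_mul (2 * ω.re : ℂ)).const_sub 1 |>.add (hasDerivAt_pow 2 z)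
    refine this.congr_deriv ?_
    simp
  have h3 : arcRoot ω ^ 2 = fun z : ℂ => 1 - 2 * ω.re * z + z ^ 2 := funext (sq_arcRoot hω)
  rw [h3] at h1
  have h4 := h1.unique h2
  refine hd.congr_deriv ?_
  rw [eq_div_iff hS]
  simp only [Nat.cast_ofNat, Nat.add_one_sub_one, pow_one] at h4
  linear_combination h4 / 2

/-! ### Boundary behaviour of `arcFactor` -/

/-- The conformal factor whose logarithm gives the singular part of the solution. -/
noncomputable def arcFactor (ω z : ℂ) : ℂ := 1 - z + arcRoot ω z

/-- A zero would force `S² = (1 - z)²`, hence `z = 0`; but there the chosen branch gives `S = 1` and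
the factor is `2`. -/
lemma arcFactor_ne_zero {ω z : ℂ} (hω : ‖ω‖ = 1) (hre : ω.re ≠ 1) : arcFactor ω z ≠ 0 := by
  intro h
  have h1 : arcRoot ω z = -(1 - z) := by rw [arcFactor] at h; linear_combination h
  have h2 := sq_arcRoot hω z
  rw [h1] at h2
  have h3 : z * (1 - ω.re) = 0 := by linear_combination - h2 / 2
  rcases mul_eq_zero.1 h3 with rfl | h3
  · simp [arcFactor, arcRoot, Complex.sqrt] at h
  · refine hre ?_
    rw [sub_eq_zero] at h3
    exact_mod_cast h3.symm

lemma re_eq_zero_of_sq_eq {w : ℂ} {r : ℝ} (h : w ^ 2 = r) (hr : r ≤ 0) : w.re = 0 := by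
  have h1 := congrArg re h
  have h2 := congrArg im h
  simp only [sq, mul_re, mul_im, ofReal_re, ofReal_im] at h1 h2
  by_contra h0
  have h3 : w.im = 0 := by
    have : w.re * w.im = 0 := by linarith
    exact (mul_eq_zero.1 this).resolve_left h0
  have := mul_self_pos.2 h0
  rw [h3] at h1
  linarith

lemma sq_arcRoot_of_norm_eq_one {ω z : ℂ} (hω : ‖ω‖ = 1) (hz : ‖z‖ = 1) :
    arcRoot ω z ^ 2 = z * (2 * z.re - 2 * ω.re : ℝ) := by
  have h1 : z * conj z = 1 := by rw [mul_conj, normSq_eq_norm_sq, hz]; simp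
  have h2 : z + conj z = 2 * z.re := by rw [add_conj, ofReal_mul, ofReal_ofNat]
  rw [sq_arcRoot hω]
  push_cast
  linear_combination z * h2 - h1

/-- On the absorbing part of the circle the modulus of `arcFactor` is constant. -/
lemma sq_norm_arcFactor {ω z : ℂ} (hω : ‖ω‖ = 1) (hz : ‖z‖ = 1) (h : ω.re ≤ z.re) :
    ‖arcFactor ω z‖ ^ 2 = 2 - 2 * ω.re := by
  have h1 : z * conj z = 1 := by rw [mul_conj, normSq_eq_norm_sq, hz]; simp
  have h2 : z + conj z = 2 * z.re := by rw [add_conj, ofReal_mul, ofReal_ofNat]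
  have hz1 : z.re ≤ 1 := hz ▸ re_le_norm z
  -- Orthogonality: the square of this product is real and nonpositive, so the cross term in `|1 - z
  -- + S|²` vanishes.
  have hc : ((1 - z) * conj (arcRoot ω z)).re = 0 := by
    refine re_eq_zero_of_sq_eq (r := (2 * z.re - 2 * ω.re) * (2 * z.re - 2)) ?_
      (mul_nonpos_of_nonneg_of_nonpos (by linarith) (by linarith))
    rw [mul_pow, ← map_pow, sq_arcRoot_of_norm_eq_one hω hz, map_mul, conj_ofReal]
    push_cast
    linear_combination (2 * z.re - 2 * ω.re : ℂ) * ((z - 2) * h1 + h2)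
  have hd : normSq (1 - z) = 2 - 2 * z.re := by
    rw [normSq_sub, normSq_eq_norm_sq z, hz]; simp; ring
  have hS : normSq (arcRoot ω z) = 2 * z.re - 2 * ω.re := by
    rw [normSq_eq_norm_sq, ← norm_pow, sq_arcRoot_of_norm_eq_one hω hz, norm_mul, hz, one_mul,
      norm_real, Real.norm_of_nonneg (by linarith)]
  rw [arcFactor, ← normSq_eq_norm_sq, normSq_add, hc, hd, hS]
  ring

/-- On the reflecting part of the circle the radial logarithmic derivative of `arcFactor` has real
part `1 / 2`. -/
lemma re_logDeriv_arcFactor {ω z : ℂ} (hω : ‖ω‖ = 1) (hz : ‖z‖ = 1) (h : z.re < ω.re)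
    (hre : ω.re ≠ 1) :
    (z * (-1 + (z - ω.re) / arcRoot ω z) / arcFactor ω z).re = 1 / 2 := by
  have h1 : z * conj z = 1 := by rw [mul_conj, normSq_eq_norm_sq, hz]; simp
  have h2 : z + conj z = 2 * z.re := by rw [add_conj, ofReal_mul, ofReal_ofNat]
  have hz1 : -1 ≤ z.re := (abs_le.1 (hz ▸ abs_re_le_norm z)).1
  have hz0 : z ≠ 0 := by rintro rfl; simp at hz
  have hS2 := sq_arcRoot hω z
  have hS : arcRoot ω z ≠ 0 := by
    intro h0
    have := sq_arcRoot_of_norm_eq_one hω hz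
    rw [h0, zero_pow two_ne_zero] at this
    rcases mul_eq_zero.1 this.symm with h3 | h3
    · exact hz0 h3
    · have h3 : 2 * z.re - 2 * ω.re = 0 := by exact_mod_cast h3
      linarith
  have hF := arcFactor_ne_zero hω hre (z := z)
  have hc : ((1 + z) * conj (arcRoot ω z)).re = 0 := by
    refine re_eq_zero_of_sq_eq (r := (2 * z.re - 2 * ω.re) * (2 * z.re + 2)) ?_
      (mul_nonpos_of_nonpos_of_nonneg (by linarith) (by linarith))
    rw [mul_pow, ← map_pow, sq_arcRoot_of_norm_eq_one hω hz, map_mul, conj_ofReal]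
    push_cast
    linear_combination (2 * z.re - 2 * ω.re : ℂ) * ((z + 2) * h1 + h2)
  -- The last term is imaginary, since `(1 + z) / S` is a real multiple of `(1 + z) * conj S`.
  have key : z * (-1 + (z - ω.re) / arcRoot ω z) / arcFactor ω z
      = 1 / 2 - (1 + z) / arcRoot ω z * (1 / 2 : ℝ) := by
    rw [div_eq_iff hF, arcFactor]
    push_cast
    field_simp
    linear_combination - hS2
  rw [key, sub_re, re_mul_ofReal, div_eq_mul_inv (1 + z), inv_def, ← mul_assoc, re_mul_ofReal, hc]
  norm_num

lemma hasDerivAt_log_norm {f : ℝ → ℂ} {f' : ℂ} {t : ℝ} (hf : HasDerivAt f f' t) (h0 : f t ≠ 0) :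
    HasDerivAt (fun s => Real.log ‖f s‖) (f' / f t).re t := by
  -- Dividing by `f t` moves the base point to `1`, off the branch cut.
  have h1 : HasDerivAt (fun s => Complex.log (f s / f t)) (f' / f t) t := by
    have := (hf.div_const (f t)).clog_real (by rw [div_self h0]; exact one_mem_slitPlane)
    simpa [h0] using this
  have h2 := (reCLM.hasFDerivAt.comp_hasDerivAt t h1).add_const (Real.log ‖f t‖)
  refine h2.congr_of_eventuallyEq ?_
  filter_upwards [hf.continuousAt.eventually_ne h0] with s hs
  simp [log_re, Real.log_div, hs, h0]

lemma hasDerivAt_log_norm_arcFactor {ω z : ℂ} (hω : ‖ω‖ = 1) (hz : ‖z‖ = 1) (h : z.re < ω.re)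
    (hre : ω.re ≠ 1) :
    HasDerivAt (fun r : ℝ => Real.log ‖arcFactor ω (r * z)‖) (1 / 2) 1 := by
  have hzz : z * conj z = 1 := by rw [mul_conj, normSq_eq_norm_sq, hz]; simp
  have hz0 : z ≠ 0 := by rintro rfl; simp at hz
  have hne : z * ω ≠ 1 := fun h1 => by
    have : ω = conj z := mul_left_cancel₀ hz0 (h1.trans hzz.symm)
    rw [this, conj_re] at h
    exact h.false
  have hne' : z * conj ω ≠ 1 := fun h1 => by
    have : conj ω = conj z := mul_left_cancel₀ hz0 (h1.trans hzz.symm)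
    rw [(starRingEnd ℂ).injective this] at h
    exact h.false
  have hS : arcRoot ω z ≠ 0 := by
    intro h0
    have := sq_arcRoot_of_norm_eq_one hω hz
    rw [h0, zero_pow two_ne_zero] at this
    rcases mul_eq_zero.1 this.symm with h3 | h3
    · exact hz0 h3
    · have h3 : 2 * z.re - 2 * ω.re = 0 := by exact_mod_cast h3
      linarith
  have hF : HasDerivAt (arcFactor ω) (-1 + (z - ω.re) / arcRoot ω z) z := by
    have := ((hasDerivAt_id z).const_sub 1).add (hasDerivAt_arcRoot hω hz.le hne hne' hS)
    exact this
  have hl : HasDerivAt (fun r : ℝ => (r : ℂ) * z) z 1 := by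
    simpa using (ofRealCLM.hasDerivAt (x := (1 : ℝ))).mul_const z
  have hc : HasDerivAt (fun r : ℝ => arcFactor ω (r * z))
      ((-1 + (z - ω.re) / arcRoot ω z) * z) 1 := by
    refine HasDerivAt.comp (1 : ℝ) (h₂ := arcFactor ω) (h := fun r : ℝ => (r : ℂ) * z) ?_ hl
    simpa using hF
  have := hasDerivAt_log_norm hc (arcFactor_ne_zero hω hre)
  rw [ofReal_one, one_mul, mul_comm _ z, re_logDeriv_arcFactor hω hz h hre] at this
  exact this

/-! ### The explicit solution -/

/-- The explicit solution of the mixed boundary value problem. -/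
noncomputable def escapeTime (p : ℂ) (ε : ℝ) (x : ℂ) : ℝ :=
  1 / 4 * (1 - ‖x‖ ^ 2) +
    (Real.log ‖arcFactor (exp (ε * I)) (conj p * x)‖ - Real.log (2 * Real.sin (ε / 2)))

lemma conj_mul_rotate {p : ℂ} (hp : ‖p‖ = 1) (w : ℂ) : conj p * (p * w) = w := by
  rw [← mul_assoc, mul_comm (conj p), mul_conj, normSq_eq_norm_sq, hp]
  simp

lemma analyticAt_arcFactor {ω z : ℂ} (hω : ‖ω‖ = 1) (hz : ‖z‖ < 1) :
    AnalyticAt ℂ (arcFactor ω) z := by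
  obtain ⟨h1, h2⟩ := norm_mul_unit hω z
  have h3 : AnalyticAt ℂ (arcRoot ω) z := analyticAt_arcRoot hω hz.le
    (fun h => by rw [h, norm_one] at h1; exact hz.ne' h1)
    (fun h => by rw [h, norm_one] at h2; exact hz.ne' h2)
  exact (analyticAt_const.sub analyticAt_id).add h3

lemma laplacian_quadratic (x : ℂ) :
    Laplacian.laplacian (fun x => 1 / 4 * (1 - ‖x‖ ^ 2) : ℂ → ℝ) x = (-1 : ℝ) := by
  have h1 : fderiv ℝ (fun x : ℂ => 1 / 4 * (1 - ‖x‖ ^ 2)) =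
      fun x => (-(1 / 2) : ℝ) • innerSL ℝ x := by
    funext y
    have : HasFDerivAt (fun x : ℂ => 1 / 4 * (1 - ‖x‖ ^ 2))
        ((1 / 4 : ℝ) • -((2 : ℕ) • innerSL ℝ y : ℂ →L[ℝ] ℝ)) y :=
      ((hasStrictFDerivAt_norm_sq y).hasFDerivAt.const_sub 1).const_mul (1 / 4 : ℝ)
    rw [this.fderiv]
    ext; simp; ring
  rw [laplacian_eq_iteratedFDeriv_complexPlane]
  simp only [iteratedFDeriv_two_apply, h1]
  have h2 : fderiv ℝ (fun x : ℂ => (-(1 / 2) : ℝ) • innerSL ℝ x) x =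
      (-(1 / 2) : ℝ) • innerSL ℝ :=
    ((innerSL ℝ (E := ℂ)).hasFDerivAt.const_smul (-(1 / 2) : ℝ)).fderiv
  rw [h2]
  change -(1 / 2) * inner ℝ (1 : ℂ) 1 + -(1 / 2) * inner ℝ I I = (-1 : ℝ)
  rw [real_inner_self_eq_norm_sq, real_inner_self_eq_norm_sq, norm_one, norm_I]
  norm_num

lemma re_exp_lt_one {ε : ℝ} (hε : 0 < ε) (hε' : ε < Real.pi) : (exp (ε * I)).re < 1 := by
  rw [exp_ofReal_mul_I_re]
  have := Real.cos_lt_cos_of_nonneg_of_le_pi le_rfl hε'.le hε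
  rwa [Real.cos_zero] at this

lemma isSolution_escapeTime {p : ℂ} {ε : ℝ} (hp : ‖p‖ = 1) (hε : 0 < ε) (hε' : ε < Real.pi) :
    IsSolution p ε (escapeTime p ε) := by
  set ω := exp (ε * I) with hωdef
  have hω : ‖ω‖ = 1 := norm_exp_ofReal_mul_I ε
  have hωre : ω.re = Real.cos ε := exp_ofReal_mul_I_re ε
  have hre : ω.re ≠ 1 := (re_exp_lt_one hε hε').ne
  have hrot : ∀ x, ‖conj p * x‖ = ‖x‖ := fun x => by simp [hp]
  have hharm : ∀ x ∈ ball (0 : ℂ) 1, HarmonicAt (fun x =>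
      Real.log ‖arcFactor ω (conj p * x)‖ - Real.log (2 * Real.sin (ε / 2))) x := fun x hx => by
    have han : AnalyticAt ℂ (fun x => arcFactor ω (conj p * x)) x := by
      refine AnalyticAt.fun_comp (g := arcFactor ω)
        (analyticAt_arcFactor hω ?_) (by fun_prop)
      rw [hrot]; simpa using hx
    exact (han.harmonicAt_log_norm (arcFactor_ne_zero hω hre)).sub (harmonicAt_const _)
  have hq : ContDiff ℝ 2 (fun x : ℂ => 1 / 4 * (1 - ‖x‖ ^ 2)) :=
    contDiff_const.mul (contDiff_const.sub (contDiff_norm_sq ℝ))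
  refine ⟨fun x hx => (hq.contDiffAt.add (hharm x hx).1).contDiffWithinAt, fun x hx => ?_,
    fun x hx => ?_, ?_, ?_⟩
  · have hc : ContinuousAt (fun x => arcFactor ω (conj p * x)) x := by
      have h1 : ContinuousAt (arcFactor ω) (conj p * x) :=
        (continuousAt_const.sub continuousAt_id).add
          (continuousAt_arcRoot hω (by rw [hrot]; simpa using hx))
      exact ContinuousAt.comp' h1 (by fun_prop)
    have h2 := hc.norm.log (norm_ne_zero_iff.2 (arcFactor_ne_zero hω hre))
    exact (hq.continuous.continuousAt.add (h2.sub continuousAt_const)).continuousWithinAt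
  · have h1 := hq.contDiffAt.laplacian_add (x := x) (hharm x hx).1
    rw [laplacian_quadratic, (hharm x hx).2.self_of_nhds] at h1
    exact h1.trans (add_zero _)
  · rintro z ⟨t, ⟨ht1, ht2⟩, rfl⟩
    have hz : ‖exp (t * I)‖ = 1 := norm_exp_ofReal_mul_I t
    have hcos : ω.re ≤ (exp (t * I)).re := by
      rw [hωre, exp_ofReal_mul_I_re, ← Real.cos_abs t]
      exact Real.cos_le_cos_of_nonneg_of_le_pi (abs_nonneg t) hε'.le (abs_lt.2 ⟨ht1, ht2⟩).le
    have hsin : 0 < Real.sin (ε / 2) := Real.sin_pos_of_pos_of_lt_pi (by linarith) (by linarith)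
    -- Half-angle formula: `2 - 2 cos ε = (2 sin (ε / 2))²`.
    have hF : ‖arcFactor ω (exp (t * I))‖ = 2 * Real.sin (ε / 2) := by
      rw [← sq_eq_sq₀ (norm_nonneg _) (by positivity), sq_norm_arcFactor hω hz hcos, hωre]
      have := Real.cos_two_mul (ε / 2)
      rw [mul_div_cancel₀ ε two_ne_zero] at this
      rw [this, mul_pow, Real.sin_sq]
      ring
    simp only [escapeTime]
    rw [conj_mul_rotate hp, ← hωdef, hF, norm_mul, hp, hz]
    simp
  · rintro z ⟨t, ⟨ht1, ht2⟩, rfl⟩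
    have hz : ‖exp (t * I)‖ = 1 := norm_exp_ofReal_mul_I t
    have hcos : (exp (t * I)).re < ω.re := by
      rw [hωre, exp_ofReal_mul_I_re]
      rcases le_total t Real.pi with h | h
      · exact Real.cos_lt_cos_of_nonneg_of_le_pi hε.le h ht1
      · rw [← Real.cos_two_pi_sub t]
        exact Real.cos_lt_cos_of_nonneg_of_le_pi hε.le (by linarith) (by linarith)
    have h1 := hasDerivAt_log_norm_arcFactor hω hz hcos hre
    have h2 : HasDerivAt (fun r : ℝ => 1 / 4 * (1 - r ^ 2)) (-(1 / 2)) 1 :=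
      (((hasDerivAt_pow 2 (1 : ℝ)).const_sub 1).const_mul (1 / 4)).congr_deriv (by norm_num)
    have h3 := (h2.add (h1.sub_const (Real.log (2 * Real.sin (ε / 2))))).hasDerivWithinAt
      (s := Iic 1)
    rw [neg_add_cancel] at h3
    refine h3.congr_of_eventuallyEq_of_mem (Eventually.of_forall fun r => ?_) self_mem_Iic
    have h4 : r • (p * exp (t * I)) = p * (r * exp (t * I)) := by
      rw [real_smul]; ring
    simp only [escapeTime, Pi.add_apply]
    rw [h4, conj_mul_rotate hp, norm_mul, norm_mul, hp, hz, norm_real, one_mul, mul_one,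
      Real.norm_eq_abs, sq_abs]

/-! ### Estimates as `ε → 0` -/

/-- Factor `a - d` as a difference of squares; principal roots have nonnegative real part, so `|√a +
√d| ≥ re √d ≥ √(|d| / 2)`. -/
lemma norm_sqrt_sub_sqrt_mul_le {a d : ℂ} (hd : 0 ≤ d.re) :
    ‖Complex.sqrt a - Complex.sqrt d‖ * √(‖d‖ / 2) ≤ ‖a - d‖ := by
  have h1 : a - d = (Complex.sqrt a - Complex.sqrt d) * (Complex.sqrt a + Complex.sqrt d) := by
    linear_combination sq_sqrt d - sq_sqrt a
  rw [h1, norm_mul]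
  refine mul_le_mul_of_nonneg_left ?_ (norm_nonneg _)
  refine le_trans ?_ (re_le_norm _)
  rw [add_re, re_sqrt, re_sqrt]
  have : √(‖d‖ / 2) ≤ √((‖d‖ + d.re) / 2) := Real.sqrt_le_sqrt (by linarith)
  linarith [Real.sqrt_nonneg ((‖a‖ + a.re) / 2)]

lemma norm_sqrt_one_sub_le {w : ℂ} (hw : ‖w‖ ≤ 1) : ‖Complex.sqrt (1 - w)‖ ≤ 2 := by
  have h1 := norm_sq_sqrt (1 - w)
  have h2 : ‖1 - w‖ ≤ 1 + ‖w‖ := by simpa using norm_sub_le 1 w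
  nlinarith [norm_nonneg (Complex.sqrt (1 - w))]

lemma norm_arcRoot_sub_le {ε c : ℝ} {z : ℂ} (hε : 0 < ε) (hc : 0 < c) (hz : ‖z‖ ≤ 1)
    (hcz : c ≤ ‖1 - z‖) : ‖arcRoot (exp (ε * I)) z - (1 - z)‖ ≤ 4 * ε / √(c / 2) := by
  set ω := exp (ε * I)
  have hω : ‖ω‖ = 1 := norm_exp_ofReal_mul_I ε
  obtain ⟨h1, h2⟩ := norm_mul_unit hω z
  have hω1 : ‖1 - ω‖ ≤ ε := by
    have := Real.norm_exp_I_mul_ofReal_sub_one_le (x := ε)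
    rwa [mul_comm, Real.norm_of_nonneg hε.le, norm_sub_rev] at this
  have hω2 : ‖1 - conj ω‖ ≤ ε := by
    rwa [← norm_conj, map_sub, map_one, conj_conj]
  have hk : 0 < √(c / 2) := Real.sqrt_pos.2 (by positivity)
  have key : ∀ η : ℂ, ‖z * η‖ = ‖z‖ → ‖1 - η‖ ≤ ε →
      ‖Complex.sqrt (1 - z * η) - Complex.sqrt (1 - z)‖ ≤ ε / √(c / 2) := fun η hη hη1 => by
    rw [le_div_iff₀ hk]
    have h3 := norm_sqrt_sub_sqrt_mul_le (a := 1 - z * η) (re_one_sub_nonneg hz)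
    have h4 : (1 - z * η) - (1 - z) = z * (1 - η) := by ring
    rw [h4, norm_mul] at h3
    have h5 : √(c / 2) ≤ √(‖1 - z‖ / 2) := Real.sqrt_le_sqrt (by linarith)
    calc _ ≤ _ := mul_le_mul_of_nonneg_left h5 (norm_nonneg _)
      _ ≤ ‖z‖ * ‖1 - η‖ := h3
      _ ≤ 1 * ε := mul_le_mul hz hη1 (norm_nonneg _) zero_le_one
      _ = ε := one_mul ε
  -- Telescoping with `1 - z = √(1 - z)²`: each term is a root difference times a root of modulus at
  -- most `2`.
  have h6 : arcRoot ω z - (1 - z) =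
      (Complex.sqrt (1 - z * ω) - Complex.sqrt (1 - z)) * Complex.sqrt (1 - z * conj ω) +
      Complex.sqrt (1 - z) * (Complex.sqrt (1 - z * conj ω) - Complex.sqrt (1 - z)) := by
    rw [arcRoot]
    linear_combination sq_sqrt (1 - z)
  rw [h6]
  calc _ ≤ _ := norm_add_le _ _
    _ ≤ ε / √(c / 2) * 2 + 2 * (ε / √(c / 2)) := by
      rw [norm_mul, norm_mul]
      gcongr
      · exact key ω h1 hω1
      · exact norm_sqrt_one_sub_le (h2.trans_le hz)
      · exact norm_sqrt_one_sub_le hz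
      · exact key _ h2 hω2
    _ = _ := by ring

lemma abs_log_norm_one_add_le {w : ℂ} (hw : ‖w‖ ≤ 1 / 2) : |Real.log ‖1 + w‖| ≤ 2 * ‖w‖ := by
  have h1 : ‖1 + w‖ ≤ 1 + ‖w‖ := by simpa using norm_add_le 1 w
  have h2 : 1 - ‖w‖ ≤ ‖1 + w‖ := by simpa using norm_sub_le_norm_add 1 w
  have h3 : 0 < ‖1 + w‖ := by linarith
  have h4 := Real.log_le_sub_one_of_pos h3
  have h5 := Real.one_sub_inv_le_log_of_pos h3
  have h6 : ‖1 + w‖⁻¹ ≤ 1 + 2 * ‖w‖ := by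
    rw [inv_le_iff_one_le_mul₀ h3]
    nlinarith [norm_nonneg w]
  rw [abs_le]
  constructor <;> linarith [norm_nonneg w]

lemma abs_log_sub_log_two_mul_sin_le {ε : ℝ} (hε : 0 < ε) (hε1 : ε ≤ 1) :
    |Real.log ε - Real.log (2 * Real.sin (ε / 2))| ≤ ε := by
  have h1 : 2 * Real.sin (ε / 2) ≤ ε := by linarith [Real.sin_lt (half_pos hε)]
  have h2 : ε - ε ^ 3 / 24 ≤ 2 * Real.sin (ε / 2) := by
    have := Real.sin_gt_sub_cube (half_pos hε)
    nlinarith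
  have h3 : ε ^ 3 ≤ ε ^ 2 := pow_le_pow_of_le_one hε.le hε1 (by norm_num)
  have h4 : ε ^ 2 ≤ ε := by nlinarith
  have h5 : 0 < 2 * Real.sin (ε / 2) := by linarith
  rw [abs_of_nonneg (sub_nonneg.2 (Real.log_le_log h5 h1)), ← Real.log_div hε.ne' h5.ne']
  refine (Real.log_le_sub_one_of_pos (by positivity)).trans ?_
  rw [sub_le_iff_le_add, div_le_iff₀ h5]
  nlinarith

end NarrowEscape

open NarrowEscape in
/-- The mixed problem is uniquely solvable, so that `u_ε` is well defined, and `u_ε` has the stated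
expansion with a remainder `O(ε)` that is uniform at distance at least `c` from the arc. -/
theorem corollary3p2 :
    (∀ (p : ℂ) (ε : ℝ), ‖p‖ = 1 → 0 < ε → ε < Real.pi →
      ∃ u : ℂ → ℝ, NarrowEscape.IsSolution p ε u ∧
        ∀ v : ℂ → ℝ, NarrowEscape.IsSolution p ε v → Set.EqOn v u (Metric.closedBall 0 1)) ∧
    (∀ c : ℝ, 0 < c → ∃ C ε₀ : ℝ, 0 < ε₀ ∧
      ∀ (p : ℂ) (ε : ℝ), ‖p‖ = 1 → 0 < ε → ε < ε₀ →
        ∀ u : ℂ → ℝ, NarrowEscape.IsSolution p ε u →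
          ∀ x ∈ Metric.ball (0 : ℂ) 1, c ≤ Metric.infDist x (NarrowEscape.absorbingArc p ε) →
            |u x - (Real.log (2 / ε) + 1 / 4 * (1 - ‖x‖ ^ 2) + Real.log ‖x - p‖)| ≤ C * ε) := by
  have huniq : ∀ (p : ℂ) (ε : ℝ), ‖p‖ = 1 → 0 < ε → ε < Real.pi → ∀ v : ℂ → ℝ,
      IsSolution p ε v → Set.EqOn v (escapeTime p ε) (Metric.closedBall 0 1) :=
    fun p ε hp hε hε' v hv x hx =>
      le_antisymm (IsSolution.le hp hε hε' (isSolution_escapeTime hp hε hε') hv hx)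
        (IsSolution.le hp hε hε' hv (isSolution_escapeTime hp hε hε') hx)
  refine ⟨fun p ε hp hε hε' =>
    ⟨escapeTime p ε, isSolution_escapeTime hp hε hε', huniq p ε hp hε hε'⟩, fun c hc => ?_⟩
  have hk : 0 < √(c / 2) := Real.sqrt_pos.2 (by positivity)
  set K : ℝ := 2 / (√(c / 2) * c) with hKdef
  have hK : 0 < K := by positivity
  -- `2 * K` bounds `log |1 + w|` below, and `1` the replacement of `2 sin (ε / 2)` by `ε`. The
  -- threshold ensures `ε < 1` and `K * ε ≤ 1 / 2`, as these two estimates require.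
  refine ⟨2 * K + 1, min 1 (1 / (2 * K)), by positivity, ?_⟩
  intro p ε hp hε hεlt u hu x hx hdist
  have hε1 : ε < 1 := hεlt.trans_le (min_le_left _ _)
  have hεK : K * ε ≤ 1 / 2 := by
    have := hεlt.trans_le (min_le_right _ _)
    rw [lt_div_iff₀ (by positivity)] at this
    linarith
  have hεpi : ε < Real.pi := hε1.trans (by linarith [Real.pi_gt_three])
  rw [huniq p ε hp hε hεpi u hu (Metric.ball_subset_closedBall hx), escapeTime]
  set z := (starRingEnd ℂ) p * x with hzdef
  have hz : ‖z‖ ≤ 1 := by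
    have : ‖x‖ < 1 := by simpa using hx
    simpa [hzdef, hp] using this.le
  have hxp : ‖x - p‖ = ‖1 - z‖ := by
    have h1 : x = p * z := by
      rw [hzdef, ← mul_assoc, Complex.mul_conj, Complex.normSq_eq_norm_sq, hp]; simp
    have h2 : x - p = -(p * (1 - z)) := by rw [h1]; ring
    rw [h2, norm_neg, norm_mul, hp, one_mul]
  have hcz : c ≤ ‖1 - z‖ := by
    rw [← hxp, ← dist_eq_norm]
    exact hdist.trans (Metric.infDist_le_dist_of_mem ⟨0, ⟨by linarith, hε⟩, by simp⟩)
  have hz1 : 1 - z ≠ 0 := norm_pos_iff.1 (hc.trans_le hcz)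
  set S := arcRoot (Complex.exp (ε * Complex.I)) z with hS
  -- The relative error in `F ≈ 2(1 - z)`: `F = (1 + w) * (2 * (1 - z))`.
  set w := (S - (1 - z)) / (2 * (1 - z)) with hw
  have hwle : ‖w‖ ≤ K * ε := by
    have h1 := norm_arcRoot_sub_le hε hc hz hcz
    rw [hw, norm_div, norm_mul, Complex.norm_ofNat, div_le_iff₀ (by positivity)]
    calc _ ≤ _ := h1
      _ = K * ε * (2 * c) := by rw [hKdef]; field_simp; ring
      _ ≤ _ := by gcongr
  have hF : arcFactor (Complex.exp (ε * Complex.I)) z = (1 + w) * (2 * (1 - z)) := by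
    rw [arcFactor, hw, ← hS]
    field_simp
    ring
  have hlog1 := abs_log_norm_one_add_le (hwle.trans hεK)
  have hw1 : ‖1 + w‖ ≠ 0 := by
    have : 1 - ‖w‖ ≤ ‖1 + w‖ := by simpa using norm_sub_le_norm_add 1 w
    linarith
  have hlog2 := abs_log_sub_log_two_mul_sin_le hε hε1.le
  rw [hF, norm_mul, norm_mul, Complex.norm_ofNat, hxp, Real.log_mul hw1 (by positivity),
    Real.log_mul two_ne_zero (norm_ne_zero_iff.2 hz1), Real.log_div two_ne_zero hε.ne']
  rw [abs_le] at hlog1 hlog2 ⊢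
  constructor <;> linarith
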